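/- Let $\mathfrak g$ be a complex simple Lie algebra of type $D_r$ with $r$ even ($r\ge 4$), or of type $E_r$ ($r=6,7,8$), let $e\in\mathfrak g$ be a subregular nilpotent element (that is, $\dim\ker\operatorname{ad}e=r+2$), and let $h,f\in\mathfrak g$ satisfy $[h,e]=2e$, $[h,f]=-2f$, $[e,f]=h$. Let $\langle\cdot,\cdot\rangle$ be the invariant bilinear form on $\mathfrak g$ with $\langle e,f\rangle=1$. Let $X_I^i$ ($1\le i\le r+2$, $-\eta_i\le I\le\eta_i$) be a basis of $\mathfrak g$ such that $$[h,X_I^i]=2I\,X_I^i,\qquad [e,X_I^i]=(\eta_i+I+1)X_{I+1}^i,\qquad [f,X_I^i]=(\eta_i-I+1)X_{I-1}^i,$$ $$\langle X_I^i,X_J^j\rangle=\delta_{i,j}\,\delta_{I,-J}\,(-1)^{\eta_i-I+1}\binom{2\eta_i}{\eta_i-I},$$ where $X_I^i=0$ for $|I|>\eta_i$, and such that $\eta_1=1$, $X_1^1=-e$, $X_0^1=h$, $X_{-1}^1=f$. Let $\xi_1,\dots,\xi_{\mathbf n}$ be an enumeration of this basis with $\xi_i=X_{-\eta_i}^i$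 for $1\le i\le r+2$, let $\xi^1,\dots,\xi^{\mathbf n}$ be the dual basis with respect to $\langle\cdot,\cdot\rangle$, and put $z^I(q)=\langle q-e,\xi^I\rangle$. Then $z^1,\dots,z^{r+2}$ are coordinates on the Slodowy slice $Q=e+\ker\operatorname{ad}f=\{z^\alpha=0,\ \alpha>r+2\}$; assign degree $2\eta_i+2$ to $z^i$. On the loop space of $\mathfrak g$ consider the Poisson bracket $$\{z^I(x),z^J(y)\}=\frac1\epsilon\,\mathbb F^{IJ}\,\delta(x-y),\qquad \mathbb F^{IJ}=\epsilon\,\langle\xi^I,\xi^J\rangle\,\partial_x+\langle\xi^I,[q(x),\xi^J]\rangle .$$ On the loop space of $Q$ the operator matrix $(\mathbb F^{\alpha\beta})_{\alpha,\beta>r+2}$ is invertible, as a matrix of formal power series in $\epsilon$ whose coefficients are linear operators on differential polynomials in $z^1,\dots,z^{r+2}$, so that the Dirac reduction $$\{z^i(x),z^j(y)\}^{\widetilde Q}=\frac1\epsilon\Big(\mathbb F^{ij}-\sum_{\alpha,\beta>r+2}\mathbb F^{i\alpha}(\mathbb F^{-1})_{\alpha\beta}\mathbb F^{\beta j}\Big)\delta(x-y),\qquad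 1\le i,j\le r+2,$$ is defined, where $(\mathbb F^{-1})_{\alpha\beta}$ denotes the inverse of $(\mathbb F^{\alpha\beta})_{\alpha,\beta>r+2}$. Its leading terms have the form $$\{z^i(x),z^j(y)\}^{[-1]}=F^{ij}(z(x))\,\delta(x-y),\qquad \{z^i(x),z^j(y)\}^{[0]}=g^{ij}(z(x))\,\delta'(x-y)+\sum_k\Gamma^{ij}_k(z(x))\,z^k_x\,\delta(x-y)$$ (the coefficients of $\epsilon^{-1}$ and $\epsilon^{0}$), where $F^{ij}$, $g^{ij}$, $\Gamma^{ij}_k$ are polynomials in $z^1,\dots,z^{r+2}$. Call a matrix $B^{ij}(z)$ of polynomials quasihomogeneous of degree $d$ if each entry $B^{ij}$ is quasihomogeneous of degree $(2\eta_i+2)+(2\eta_j+2)+d$ (the zero polynomial is quasihomogeneous of every degree). Then the matrix $g^{ij}(z)$ is quasihomogeneous of degree $-4$, the matrix $F^{ij}(z)$ is quasihomogeneous of degree $-2$, and for every $k$ the matrix $\Gamma^{ij}_k(z)$ is quasihomogeneous of degree $-(2\eta_k+2)-4$. -/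

import Mathlib

/-! ### Simple Lie algebras of type `D_r` (`r` even) and `E_r`, subregular nilpotents -/

/-- `L` is isomorphic to the complex simple Lie algebra of type `D_r` with `r` even, or of type
`E₆`, `E₇` or `E₈` (then `r` is `6`, `7` or `8`). In all cases `r` is the rank of `L`. -/
def IsTypeEvenDOrE (L : Type*) [LieRing L] [LieAlgebra ℂ L] (r : ℕ) : Prop :=
  (Even r ∧ 4 ≤ r ∧ Nonempty (L ≃ₗ⁅ℂ⁆ CartanMatrix.dₙ ℂ r)) ∨
  (r = 6 ∧ Nonempty (L ≃ₗ⁅ℂ⁆ LieAlgebra.e₆ ℂ)) ∨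
  (r = 7 ∧ Nonempty (L ≃ₗ⁅ℂ⁆ LieAlgebra.e₇ ℂ)) ∨
  (r = 8 ∧ Nonempty (L ≃ₗ⁅ℂ⁆ LieAlgebra.e₈ ℂ))

/-- `e` is a subregular nilpotent element of `L`, where `r` is the rank of `L`. -/
def IsSubregularNilpotent {L : Type*} [LieRing L] [LieAlgebra ℂ L] (r : ℕ) (e : L) : Prop :=
  IsNilpotent (LieAlgebra.ad ℂ L e) ∧
    Module.finrank ℂ (LinearMap.ker (LieAlgebra.ad ℂ L e)) = r + 2

/-- The multiple of the Killing form normalized by `⟨e, f⟩ = 1`. On a simple Lie algebra it is the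
unique invariant bilinear form with this normalization. -/
noncomputable def normalizedForm {L : Type*} [LieRing L] [LieAlgebra ℂ L] (e f : L) :
    LinearMap.BilinForm ℂ L :=
  (killingForm ℂ L e f)⁻¹ • killingForm ℂ L

/-! ### Normalized bases adapted to an `sl₂`-triple -/

/-- The index set of the vectors `X_I^i`, `-η_i ≤ I ≤ η_i`. -/
abbrev WtIdx {n : ℕ} (η : Fin n → ℕ) : Type :=
  Σ i : Fin n, Set.Icc (-(η i : ℤ)) (η i : ℤ)

/-- The index `(i, -η_i)` of the lowest weight vector `X_{-η_i}^i`. -/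
def lowIdx {n : ℕ} (η : Fin n → ℕ) (i : Fin n) : WtIdx η :=
  ⟨i, ⟨-(η i : ℤ), le_refl _, by omega⟩⟩

/-- The indices of all the vectors `X_I^i` that are not lowest weight vectors. -/
abbrev ConIdx {n : ℕ} (η : Fin n → ℕ) : Type :=
  {p : WtIdx η // (p.2 : ℤ) ≠ -(η p.1 : ℤ)}

/-- `X_I^i` for every integer `I`, with the convention `X_I^i = 0` for `|I| > η_i`. -/
noncomputable def basisVec {L : Type*} [LieRing L] [LieAlgebra ℂ L] {n : ℕ} {η : Fin n → ℕ}
    (X : Module.Basis (WtIdx η) ℂ L) (i : Fin n) (I : ℤ) : L :=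
  if hI : I ∈ Set.Icc (-(η i : ℤ)) (η i : ℤ) then X ⟨i, ⟨I, hI⟩⟩ else 0

/-- A normalized basis `X_I^i`, `i = 1, …, r + 2`, `-η_i ≤ I ≤ η_i`, of `L` adapted to the
`sl₂`-triple `e, h, f`: for each `i` the vectors `X_I^i` span an irreducible `sl₂`-submodule `V^i`
of dimension `2 η_i + 1`, on which `e, h, f` act in the standard way, the first submodule is the
`sl₂`-subalgebra itself, and the pairings are normalized. The index `i : Fin (r + 2)` starts
at `0`. -/
structure NormalizedBasis {L : Type*} [LieRing L] [LieAlgebra ℂ L] (e h f : L) {r : ℕ}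
    (η : Fin (r + 2) → ℕ) where
  X : Module.Basis (WtIdx η) ℂ L
  lie_h : ∀ i, ∀ I ∈ Set.Icc (-(η i : ℤ)) (η i : ℤ),
    ⁅h, basisVec X i I⁆ = (2 * (I : ℂ)) • basisVec X i I
  lie_e : ∀ i, ∀ I ∈ Set.Icc (-(η i : ℤ)) (η i : ℤ),
    ⁅e, basisVec X i I⁆ = ((η i : ℂ) + (I : ℂ) + 1) • basisVec X i (I + 1)
  lie_f : ∀ i, ∀ I ∈ Set.Icc (-(η i : ℤ)) (η i : ℤ),
    ⁅f, basisVec X i I⁆ = ((η i : ℂ) - (I : ℂ) + 1) • basisVec X i (I - 1)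
  form_apply : ∀ i j, ∀ I ∈ Set.Icc (-(η i : ℤ)) (η i : ℤ),
    ∀ J ∈ Set.Icc (-(η j : ℤ)) (η j : ℤ),
      normalizedForm e f (basisVec X i I) (basisVec X j J) =
        if i = j ∧ I = -J then
          (-1 : ℂ) ^ ((η i : ℤ) - I + 1) * ((2 * η i).choose ((η i : ℤ) - I).toNat : ℂ)
        else 0
  weight_zero : η 0 = 1
  vec_zero_one : basisVec X 0 1 = -e
  vec_zero_zero : basisVec X 0 0 = h
  vec_zero_neg_one : basisVec X 0 (-1) = f

namespace NormalizedBasis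

variable {L : Type*} [LieRing L] [LieAlgebra ℂ L] {e h f : L} {r : ℕ} {η : Fin (r + 2) → ℕ}

theorem basisVec_coe (X : Module.Basis (WtIdx η) ℂ L) (p : WtIdx η) :
    basisVec X p.1 p.2 = X p := by
  obtain ⟨i, I, hI⟩ := p
  simp only [basisVec]
  rw [dif_pos hI]

theorem normalizedForm_symm (x y : L) : normalizedForm e f x y = normalizedForm e f y x := by
  simp only [normalizedForm, LinearMap.smul_apply]
  rw [LieModule.traceForm_comm ℂ L L x y]

/-- The normalized form is nondegenerate, as its Gram matrix in the basis shows. -/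
theorem nondegenerate (N : NormalizedBasis e h f η) :
    (normalizedForm e f : LinearMap.BilinForm ℂ L).Nondegenerate := by
  have key : ∀ x : L, (∀ y, normalizedForm e f x y = 0) → x = 0 := by
    intro x hx
    apply N.X.ext_elem
    intro p
    have hneg : -(p.2 : ℤ) ∈ Set.Icc (-(η p.1 : ℤ)) (η p.1 : ℤ) := by
      have := p.2.2
      simp only [Set.mem_Icc] at this ⊢
      omega
    have h1 := hx (N.X ⟨p.1, ⟨-(p.2 : ℤ), hneg⟩⟩)
    rw [← N.X.sum_repr x, map_sum, LinearMap.sum_apply, Finset.sum_eq_single p] at h1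
    · rw [map_smul, LinearMap.smul_apply, ← basisVec_coe N.X p,
        ← basisVec_coe N.X ⟨p.1, ⟨-(p.2 : ℤ), hneg⟩⟩,
        N.form_apply _ _ _ p.2.2 _ hneg] at h1
      simp only [neg_neg, and_self, if_true, smul_eq_mul] at h1
      have hc : ((2 * η p.1).choose ((η p.1 : ℤ) - p.2).toNat : ℂ) ≠ 0 := by
        have := p.2.2
        simp only [Set.mem_Icc] at this
        exact_mod_cast (Nat.choose_pos (by omega)).ne'
      have hs : (-1 : ℂ) ^ ((η p.1 : ℤ) - p.2 + 1) ≠ 0 := zpow_ne_zero _ (by norm_num)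
      simpa [hc, hs] using h1
    · intro q _ hqp
      rw [map_smul, LinearMap.smul_apply, ← basisVec_coe N.X q,
        ← basisVec_coe N.X ⟨p.1, ⟨-(p.2 : ℤ), hneg⟩⟩,
        N.form_apply _ _ _ q.2.2 _ hneg, if_neg, smul_zero]
      rintro ⟨ha, hb⟩
      apply hqp
      obtain ⟨i, I, hI⟩ := p
      obtain ⟨j, J, hJ⟩ := q
      simp only [neg_neg] at ha hb
      subst ha
      subst hb
      rfl
    · simp
  refine ⟨key, fun x hx => key x fun y => ?_⟩
  rw [normalizedForm_symm]
  exact hx y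

/-- The dual basis `ξ^I` of the basis `ξ_I = X_I^i` with respect to the normalized form. -/
noncomputable def dual (N : NormalizedBasis e h f η) : Module.Basis (WtIdx η) ℂ L :=
  (normalizedForm e f).dualBasis N.nondegenerate N.X

end NormalizedBasis

/-! ### Local operators on the loop space of the slice -/

/-- Differential polynomials in `z^1, …, z^n`; the variable `(i, m)` is `∂_x^m z^i(x)`. -/
abbrev DiffPoly (n : ℕ) : Type := MvPolynomial (Fin n × ℕ) ℂ

/-- The total derivative `∂_x` of differential polynomials. -/
noncomputable def totalDeriv (n : ℕ) : Derivation ℂ (DiffPoly n) (DiffPoly n) :=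
  MvPolynomial.mkDerivation ℂ fun p => MvPolynomial.X (p.1, p.2 + 1)

/-- A function of the coordinates `z^1, …, z^n` as a differential polynomial without
derivatives. -/
noncomputable def toDiffPoly {n : ℕ} (P : MvPolynomial (Fin n) ℂ) : DiffPoly n :=
  MvPolynomial.rename (fun i => (i, 0)) P

/-- Formal power series in the parameter `ε` whose coefficients are linear operators on
differential polynomials, such as `a ∂_x^m`, which represents `a(x) δ^{(m)}(x - y)`. The product is
the composition of operators. -/
abbrev LocalOp (n : ℕ) : Type := PowerSeries (Module.End ℂ (DiffPoly n))

/-- Dirac reduction of an operator-valued Poisson matrix `P`: the indices `s i` are those of the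
coordinates that are kept, the indices `t α` those of the constraints, and
`P^{ij} - P^{iα} (P^{-1})_{αβ} P^{βj}` is returned, where `(P^{-1})_{αβ}` is the two-sided inverse
of the matrix `P^{αβ}` (which is required to exist wherever this is used). -/
noncomputable def diracReduction {R : Type*} [Ring R] {J ι κ : Type*} [Fintype κ] [DecidableEq κ]
    (P : Matrix J J R) (s : ι → J) (t : κ → J) : Matrix ι ι R :=
  P.submatrix s s - P.submatrix s t * Ring.inverse (P.submatrix t t) * P.submatrix t s

namespace NormalizedBasis

variable {L : Type*} [LieRing L] [LieAlgebra ℂ L] {e h f : L} {r : ℕ} {η : Fin (r + 2) → ℕ}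

/-- The entry `⟨ξ^I, [q, ξ^J]⟩` of the Lie-Poisson structure at the point
`q = e + ∑ z^i X_{-η_i}^i` of the Slodowy slice `e + ker (ad f)`. -/
noncomputable def liePoissonEntry (N : NormalizedBasis e h f η) (p q : WtIdx η) :
    DiffPoly (r + 2) :=
  MvPolynomial.C (normalizedForm e f (N.dual p) ⁅e, N.dual q⁆) +
    ∑ i, MvPolynomial.C (normalizedForm e f (N.dual p) ⁅N.X (lowIdx η i), N.dual q⁆) *
      MvPolynomial.X (i, 0)

/-- The restriction to the loop space of the Slodowy slice of the operator matrix
`𝔽^{IJ} = ε ⟨ξ^I, ξ^J⟩ ∂_x + ⟨ξ^I, [q(x), ξ^J]⟩` of the Poisson bracket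
`{z^I(x), z^J(y)} = (1/ε) 𝔽^{IJ} δ(x - y)` on the loop space of `L`, that is of
`{𝓕, 𝓘} = (1/ε) (δ𝓕 | [ε ∂_x + q, δ𝓘])`, in the coordinates `z^I(q) = ⟨q - e, ξ^I⟩`. -/
noncomputable def loopOperator (N : NormalizedBasis e h f η) :
    Matrix (WtIdx η) (WtIdx η) (LocalOp (r + 2)) :=
  Matrix.of fun p q =>
    PowerSeries.C (LinearMap.mulLeft ℂ (N.liePoissonEntry p q)) +
      PowerSeries.X * PowerSeries.C
        (normalizedForm e f (N.dual p) (N.dual q) • (totalDeriv (r + 2)).toLinearMap)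

/-- The matrix `𝔽^{αβ}` of the operators of the constraints `z^α = 0` that cut out the slice, where
`α` runs over the vectors of the basis that are not lowest weight vectors. -/
noncomputable def constraintOperator (N : NormalizedBasis e h f η) :
    Matrix (ConIdx η) (ConIdx η) (LocalOp (r + 2)) :=
  N.loopOperator.submatrix Subtype.val Subtype.val

/-- The operator matrix of the Dirac-reduced bracket on the loop space of the Slodowy slice:
`{z^i(x), z^j(y)} = (1/ε) (N.sliceOperator i j) δ(x - y)`. -/
noncomputable def sliceOperator (N : NormalizedBasis e h f η) :
    Matrix (Fin (r + 2)) (Fin (r + 2)) (LocalOp (r + 2)) :=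
  diracReduction N.loopOperator (lowIdx η) (Subtype.val : ConIdx η → WtIdx η)

end NormalizedBasis

/-- The local Poisson bracket `{z^i(x), z^j(y)} = (1/ε) S^{ij} δ(x - y)` has the leading terms
`F^{ij}(z(x)) δ(x - y)` at `ε^{-1}` and
`g^{ij}(z(x)) δ'(x - y) + ∑_k Γ^{ij}_k(z(x)) z_x^k δ(x - y)` at `ε^0`. -/
def HasLeadingTerms {n : ℕ} (S : Matrix (Fin n) (Fin n) (LocalOp n))
    (F g : Matrix (Fin n) (Fin n) (MvPolynomial (Fin n) ℂ))
    (Γ : Fin n → Fin n → Fin n → MvPolynomial (Fin n) ℂ) : Prop :=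
  ∀ i j,
    PowerSeries.coeff 0 (S i j) = LinearMap.mulLeft ℂ (toDiffPoly (F i j)) ∧
    PowerSeries.coeff 1 (S i j) =
      LinearMap.mulLeft ℂ (toDiffPoly (g i j)) * (totalDeriv n).toLinearMap +
        LinearMap.mulLeft ℂ (∑ k, toDiffPoly (Γ i j k) * MvPolynomial.X (k, 1))

/-! ### Quasihomogeneity -/

/-- The degree `2 η_i + 2` of the coordinate `z^i`. -/
def slodowyDegree {n : ℕ} (η : Fin n → ℕ) (i : Fin n) : ℤ := 2 * (η i : ℤ) + 2

/-- A matrix of polynomials in variables of degrees `w i` is quasihomogeneous of degree `d` if its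
entry at `(i, j)` is quasihomogeneous of degree `w i + w j + d`. -/
def IsQuasihomogeneousMatrix {n : ℕ} (w : Fin n → ℤ)
    (B : Matrix (Fin n) (Fin n) (MvPolynomial (Fin n) ℂ)) (d : ℤ) : Prop :=
  ∀ i j, MvPolynomial.IsWeightedHomogeneous w (B i j) (w i + w j + d)

/-!
The differential polynomials are graded by giving `∂_x^m z^i` the degree `2 η_i + 2 + 2 m`. Then
`∂_x` has degree `2`, the parameter `ε` has degree `0`, and the entry `𝔽^{IJ}` of the operator
matrix on the loop space of the slice is homogeneous of degree `(1 - 2 I) + (1 - 2 J)`. Indeed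
`ξ^I` is an eigenvector of `ad h` with eigenvalue `-2 I`, hence the three parts of `𝔽^{IJ}`, which
come from `e`, from `X_{-η_i}^i` and from `∂_x`, vanish unless `I + J` is `1`, `-η_i` and `0`
(`NormalizedBasis.scaleOp_loopOperator`).

The constraint block is invertible because its constant term in `ε` is. The latter is a matrix of
polynomials on the slice; the operator `ad e` contributes a monomial matrix supported on
`I + J = 1`, and all other entries have `I + J ≤ 0`, so that after a permutation of the rows the
matrix is triangular with nonzero constants on the diagonal
(`NormalizedBasis.isUnit_liePoissonPoly_submatrix`).

A degree of the form `a_p + a_q` for the entries of a Poisson matrix is inherited by the Dirac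
reduction. To avoid expanding the inverse, homogeneity is expressed by the automorphism that
multiplies a variable of degree `w` by `2^w`: it multiplies the entries of the constraint block by
`2^{a_p + a_q}`, so by uniqueness of inverses it multiplies those of the inverse by
`2^{-a_p - a_q}` (`map_diracReduction_apply`). At the lowest weights this gives the degree
`(2 η_i + 2) + (2 η_j + 2) - 2`. It is the degree of `F^{ij}`, while `∂_x` takes up `2` of it in
`g^{ij} ∂_x`, and `z_x^k` takes up `2 η_k + 4` in `Γ^{ij}_k z_x^k`.

The leading terms have the claimed form because the operators
`F + ε (g ∂_x + ∑_k γ_k z_x^k) + O(ε²)` form a ring (`leadingSubring`), and because modulo `ε²`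
the inverse of a matrix `M` over this ring is a polynomial expression in `M` and the inverse of its
constant term.
-/

/-! ### Matrices of formal power series over a noncommutative ring -/

section MatrixPowerSeries

variable {κ R : Type*} [Fintype κ] [DecidableEq κ] [Ring R]

/-- A power series with matrix coefficients, regarded as a matrix of power series. -/
noncomputable def PowerSeries.toMatrix :
    PowerSeries (Matrix κ κ R) →+* Matrix κ κ (PowerSeries R) where
  toFun φ := Matrix.of fun i j => PowerSeries.mk fun n => PowerSeries.coeff n φ i j
  map_one' := by
    ext i j n
    by_cases hn : n = 0 <;> by_cases hij : i = j <;>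
      simp [PowerSeries.coeff_one, Matrix.one_apply, hn, hij]
  map_zero' := by
    ext i j n
    simp
  map_add' φ ψ := by
    ext i j n
    simp
  map_mul' φ ψ := by
    ext i j n
    simp only [Matrix.of_apply, PowerSeries.coeff_mk, Matrix.mul_apply, PowerSeries.coeff_mul,
      map_sum, Matrix.sum_apply]
    rw [Finset.sum_comm]

theorem Matrix.isUnit_of_isUnit_map_constantCoeff {M : Matrix κ κ (PowerSeries R)}
    (hM : IsUnit (M.map (PowerSeries.coeff 0))) : IsUnit M := by
  have h : M = PowerSeries.toMatrix
      (PowerSeries.mk fun n => M.map (PowerSeries.coeff n) : PowerSeries (Matrix κ κ R)) := by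
    ext i j n
    simp [PowerSeries.toMatrix]
  rw [h]
  refine IsUnit.map _ (PowerSeries.isUnit_iff_constantCoeff.mpr ?_)
  rwa [← PowerSeries.coeff_zero_eq_constantCoeff_apply, PowerSeries.coeff_mk]

end MatrixPowerSeries

/-! ### Local operators with prescribed leading terms -/

section LeadingTerms

open MvPolynomial

variable {n : ℕ}

theorem totalDeriv_toDiffPoly (P : MvPolynomial (Fin n) ℂ) :
    totalDeriv n (toDiffPoly P) = ∑ k, toDiffPoly (pderiv k P) * X (k, 1) := by
  induction P using MvPolynomial.induction_on with
  | C a => simp [toDiffPoly, totalDeriv]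
  | add p q hp hq =>
    simp only [toDiffPoly, map_add, add_mul, Finset.sum_add_distrib] at hp hq ⊢
    rw [hp, hq]
  | mul_X p i hp =>
    simp only [toDiffPoly, map_mul, rename_X, Derivation.leibniz, smul_eq_mul, map_add,
      add_mul, Finset.sum_add_distrib] at hp ⊢
    rw [hp, Finset.mul_sum]
    congr 1
    · rw [Finset.sum_eq_single i]
      · simp [totalDeriv]
      · intro k _ hk
        simp [pderiv_X_of_ne hk.symm]
      · simp
    · exact Finset.sum_congr rfl fun k _ => by ring

/-- The commutation rule `∂_x ∘ a = a ∘ ∂_x + a_x` in the ring of operators. -/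
theorem totalDeriv_mul_mulLeft (a : DiffPoly n) :
    (totalDeriv n).toLinearMap * LinearMap.mulLeft ℂ a =
      LinearMap.mulLeft ℂ a * (totalDeriv n).toLinearMap +
        LinearMap.mulLeft ℂ (totalDeriv n a) := by
  refine LinearMap.ext fun x => ?_
  simp [mul_comm]

/-- Polynomial functions on the slice, acting on differential polynomials by multiplication. -/
noncomputable def mulOp (n : ℕ) :
    MvPolynomial (Fin n) ℂ →+* Module.End ℂ (DiffPoly n) :=
  (Algebra.lmul ℂ (DiffPoly n)).toRingHom.comp
    (rename (R := ℂ) (fun i : Fin n => ((i, 0) : Fin n × ℕ))).toRingHom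

theorem mulOp_apply (P : MvPolynomial (Fin n) ℂ) :
    mulOp n P = LinearMap.mulLeft ℂ (toDiffPoly P) := rfl

/-- The multiplication operator by the differential polynomial `∑_k γ_k z_x^k`. -/
noncomputable def linOp (γ : Fin n → MvPolynomial (Fin n) ℂ) : Module.End ℂ (DiffPoly n) :=
  LinearMap.mulLeft ℂ (∑ k, toDiffPoly (γ k) * X (k, 1))

theorem linOp_add (γ δ : Fin n → MvPolynomial (Fin n) ℂ) :
    linOp (γ + δ) = linOp γ + linOp δ := by
  refine LinearMap.ext fun x => ?_
  simp [linOp, toDiffPoly, add_mul, Finset.sum_add_distrib]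

theorem linOp_smul (P : MvPolynomial (Fin n) ℂ) (γ : Fin n → MvPolynomial (Fin n) ℂ) :
    linOp (P • γ) = mulOp n P * linOp γ := by
  refine LinearMap.ext fun x => ?_
  simp [linOp, mulOp_apply, toDiffPoly, Finset.sum_mul, mul_assoc]

theorem linOp_neg (γ : Fin n → MvPolynomial (Fin n) ℂ) : linOp (-γ) = -linOp γ := by
  refine LinearMap.ext fun x => ?_
  simp [linOp, toDiffPoly]

theorem linOp_mul_mulOp (P : MvPolynomial (Fin n) ℂ) (γ : Fin n → MvPolynomial (Fin n) ℂ) :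
    linOp γ * mulOp n P = mulOp n P * linOp γ := by
  refine LinearMap.ext fun x => ?_
  simp [linOp, mulOp_apply, mul_left_comm]

theorem totalDeriv_mul_mulOp (P : MvPolynomial (Fin n) ℂ) :
    (totalDeriv n).toLinearMap * mulOp n P =
      mulOp n P * (totalDeriv n).toLinearMap + linOp fun k => pderiv k P := by
  rw [mulOp_apply, totalDeriv_mul_mulLeft, totalDeriv_toDiffPoly, linOp]

theorem coeff_one_mul_eq {R : Type*} [Semiring R] (S T : PowerSeries R) :
    PowerSeries.coeff 1 (S * T) =
      PowerSeries.coeff 0 S * PowerSeries.coeff 1 T +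
        PowerSeries.coeff 1 S * PowerSeries.coeff 0 T := by
  simp [PowerSeries.coeff_mul, Finset.Nat.antidiagonal_succ]

theorem coeff_zero_mul_eq {R : Type*} [Semiring R] (S T : PowerSeries R) :
    PowerSeries.coeff 0 (S * T) = PowerSeries.coeff 0 S * PowerSeries.coeff 0 T := by
  simp

/-- The local operators `F + ε (g ∂_x + ∑_k γ_k z_x^k) + O(ε²)`, where `F`, `g` and the `γ_k` are
polynomial functions on the slice. They form a ring because `[∂_x, P] = ∑_k (∂P/∂z^k) z_x^k`. -/
noncomputable def leadingSubring (n : ℕ) : Subring (LocalOp n) where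
  carrier := {S | ∃ F g : MvPolynomial (Fin n) ℂ, ∃ γ : Fin n → MvPolynomial (Fin n) ℂ,
    PowerSeries.coeff 0 S = mulOp n F ∧
      PowerSeries.coeff 1 S = mulOp n g * (totalDeriv n).toLinearMap + linOp γ}
  zero_mem' := ⟨0, 0, 0, by simp, by simp [linOp, toDiffPoly]⟩
  one_mem' := ⟨1, 0, 0, by simp, by simp [PowerSeries.coeff_one, linOp, toDiffPoly]⟩
  add_mem' := by
    rintro S T ⟨F, g, γ, h₀, h₁⟩ ⟨F', g', γ', h₀', h₁'⟩
    refine ⟨F + F', g + g', γ + γ', by rw [map_add, h₀, h₀', map_add], ?_⟩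
    rw [map_add, h₁, h₁', map_add, linOp_add]
    noncomm_ring
  neg_mem' := by
    rintro S ⟨F, g, γ, h₀, h₁⟩
    refine ⟨-F, -g, -γ, by rw [map_neg, h₀, map_neg], ?_⟩
    rw [map_neg, h₁, map_neg, linOp_neg, neg_add]
    exact congrArg (· + -linOp γ) (neg_mul (mulOp n g) _).symm
  mul_mem' := by
    rintro S T ⟨F, g, γ, h₀, h₁⟩ ⟨F', g', γ', h₀', h₁'⟩
    refine ⟨F * F', F * g' + g * F', F • γ' + (g • (fun k => pderiv k F') + F' • γ),
      by rw [coeff_zero_mul_eq, h₀, h₀', map_mul], ?_⟩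
    rw [coeff_one_mul_eq, h₀, h₀', h₁, h₁', linOp_add, linOp_add, linOp_smul, linOp_smul,
      linOp_smul, map_add, map_mul, map_mul, add_mul (mulOp n g * _), mul_assoc (mulOp n g),
      totalDeriv_mul_mulOp, linOp_mul_mulOp]
    noncomm_ring

theorem mem_leadingSubring_of_coeff_eq {S T : LocalOp n} (hT : T ∈ leadingSubring n)
    (h₀ : PowerSeries.coeff 0 S = PowerSeries.coeff 0 T)
    (h₁ : PowerSeries.coeff 1 S = PowerSeries.coeff 1 T) : S ∈ leadingSubring n := by
  obtain ⟨F, g, γ, hF, hg⟩ := hT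
  exact ⟨F, g, γ, h₀.trans hF, h₁.trans hg⟩

theorem C_mulOp_mem_leadingSubring (P : MvPolynomial (Fin n) ℂ) :
    (PowerSeries.C (mulOp n P) : LocalOp n) ∈ leadingSubring n :=
  ⟨P, 0, 0, by simp, by simp [linOp, toDiffPoly]⟩

variable {κ : Type*} [Fintype κ]

theorem mul_apply_mem_leadingSubring {ι ι' : Type*} {M : Matrix ι κ (LocalOp n)}
    {M' : Matrix κ ι' (LocalOp n)}
    (hM : ∀ p q, M p q ∈ leadingSubring n) (hM' : ∀ p q, M' p q ∈ leadingSubring n) (p q) :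
    (M * M') p q ∈ leadingSubring n := by
  rw [Matrix.mul_apply]
  exact Subring.sum_mem _ fun k _ => Subring.mul_mem _ (hM _ _) (hM' _ _)

variable [DecidableEq κ]

/-- Modulo `ε²` the inverse of `M` is `B (2 - M B)`, where `B` is the inverse of the constant term
of `M`. -/
theorem inverse_apply_mem_leadingSubring {M : Matrix κ κ (LocalOp n)}
    {A : Matrix κ κ (MvPolynomial (Fin n) ℂ)} (hA : IsUnit A)
    (h₀ : ∀ p q, PowerSeries.coeff 0 (M p q) = mulOp n (A p q))
    (hM : ∀ p q, M p q ∈ leadingSubring n) {M' : Matrix κ κ (LocalOp n)} (hM' : M' * M = 1)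
    (p q) : M' p q ∈ leadingSubring n := by
  obtain ⟨B, hAB, -⟩ := isUnit_iff_exists.mp hA
  set B' : Matrix κ κ (LocalOp n) := B.map fun P => PowerSeries.C (mulOp n P) with hB'
  have hB'mem : ∀ p q, B' p q ∈ leadingSubring n := fun p q => C_mulOp_mem_leadingSubring _
  have hone : ∀ p q, (1 : Matrix κ κ (LocalOp n)) p q ∈ leadingSubring n := by
    intro p q
    rw [Matrix.one_apply]
    split_ifs
    exacts [Subring.one_mem _, Subring.zero_mem _]
  set Q : Matrix κ κ (LocalOp n) := M * B' - 1 with hQ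
  have hQ₀ : ∀ p q, PowerSeries.coeff 0 (Q p q) = 0 := by
    intro p q
    have h := congrArg (mulOp n) (congrFun (congrFun hAB p) q)
    rw [Matrix.mul_apply, map_sum] at h
    rw [hQ, Matrix.sub_apply, map_sub, Matrix.mul_apply, map_sum, sub_eq_zero]
    simp only [coeff_zero_mul_eq, h₀, hB', Matrix.map_apply, PowerSeries.coeff_zero_C, ← map_mul, h]
    simp only [Matrix.one_apply]
    split_ifs <;> simp
  have hQQ : ∀ p q, PowerSeries.coeff 0 ((Q * Q) p q) = 0 ∧
      PowerSeries.coeff 1 ((Q * Q) p q) = 0 := by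
    intro p q
    simp only [Matrix.mul_apply, map_sum, coeff_zero_mul_eq, coeff_one_mul_eq, hQ₀]
    simp
  have key : M' = B' * (1 - Q) + M' * (Q * Q) := by
    have h1 : M * B' = 1 + Q := by rw [hQ]; abel
    have h2 : B' = M' * (1 + Q) := by rw [← h1, ← Matrix.mul_assoc, hM', Matrix.one_mul]
    have h3 : (1 + Q) * (1 - Q) + Q * Q = 1 := by
      clear_value Q
      rw [add_mul, mul_sub, mul_sub, one_mul, mul_one, one_mul]
      abel
    rw [h2, Matrix.mul_assoc, ← Matrix.mul_add, h3, Matrix.mul_one]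
  have hQmem : ∀ p q, Q p q ∈ leadingSubring n := fun p q =>
    Subring.sub_mem _ (mul_apply_mem_leadingSubring hM hB'mem p q) (hone p q)
  refine mem_leadingSubring_of_coeff_eq
    (mul_apply_mem_leadingSubring (M' := 1 - Q) hB'mem
      (fun p q => Subring.sub_mem _ (hone p q) (hQmem p q)) p q) ?_ ?_
  · conv_lhs => rw [key]
    rw [Matrix.add_apply, map_add, Matrix.mul_apply (M := M'), map_sum]
    simp only [coeff_zero_mul_eq, (hQQ _ _).1]
    simp
  · conv_lhs => rw [key]
    rw [Matrix.add_apply, map_add, Matrix.mul_apply (M := M'), map_sum]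
    simp only [coeff_one_mul_eq, (hQQ _ _).1, (hQQ _ _).2]
    simp

end LeadingTerms

/-! ### Rescaling of variables and quasihomogeneity -/

section Scaling

open MvPolynomial

/-- The automorphism `X_i ↦ 2^{w_i} X_i` of a polynomial ring. Since `2` is not a root of unity, its
eigenspaces are the weighted homogeneous components. -/
noncomputable def scaling {σ : Type*} (w : σ → ℤ) : MvPolynomial σ ℂ ≃ₐ[ℂ] MvPolynomial σ ℂ :=
  AlgEquiv.ofAlgHom (aeval fun i => (2 : ℂ) ^ w i • X i) (aeval fun i => (2 : ℂ) ^ (-w i) • X i)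
    (by
      ext i : 1
      have h : (2 : ℂ) ^ w i ≠ 0 := zpow_ne_zero _ two_ne_zero
      simp [smul_smul, h])
    (by
      ext i : 1
      have h : (2 : ℂ) ^ w i ≠ 0 := zpow_ne_zero _ two_ne_zero
      simp [smul_smul, h])

@[simp]
theorem scaling_X {σ : Type*} (w : σ → ℤ) (i : σ) : scaling w (X i) = (2 : ℂ) ^ w i • X i := by
  simp [scaling]

@[simp]
theorem scaling_C {σ : Type*} (w : σ → ℤ) (a : ℂ) : scaling w (C a) = C a :=
  (scaling w).commutes a

theorem scaling_monomial {σ : Type*} (w : σ → ℤ) (d : σ →₀ ℕ) (a : ℂ) :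
    scaling w (monomial d a) = (2 : ℂ) ^ Finsupp.weight w d • monomial d a := by
  induction d using Finsupp.induction_linear generalizing a with
  | zero => simp
  | add d₁ d₂ h₁ h₂ =>
    have h : monomial (d₁ + d₂) a = monomial d₁ a * monomial d₂ 1 := by
      rw [monomial_mul, mul_one]
    rw [h, map_mul, h₁, h₂, map_add, zpow_add₀ two_ne_zero, smul_mul_smul_comm]
  | single i k =>
    have h : monomial (Finsupp.single i k) a = C a * X i ^ k := by
      rw [C_mul_X_pow_eq_monomial]
    rw [h, map_mul, scaling_C, map_pow, scaling_X, smul_pow, Finsupp.weight_single, nsmul_eq_mul,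
      mul_comm (k : ℤ), zpow_mul, zpow_natCast, mul_smul_comm]

theorem coeff_scaling {σ : Type*} (w : σ → ℤ) (P : MvPolynomial σ ℂ) (d : σ →₀ ℕ) :
    coeff d (scaling w P) = (2 : ℂ) ^ Finsupp.weight w d * coeff d P := by
  induction P using MvPolynomial.induction_on' with
  | monomial u a =>
    classical
    rw [scaling_monomial, coeff_smul, smul_eq_mul, coeff_monomial]
    split_ifs with h
    · rw [h]
    · simp
  | add p q hp hq => rw [map_add, coeff_add, coeff_add, hp, hq, mul_add]

theorem two_zpow_injective : Function.Injective fun k : ℤ => (2 : ℂ) ^ k := by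
  intro a b hab
  have h := congrArg norm hab
  simp only [norm_zpow, Complex.norm_ofNat] at h
  exact zpow_right_injective₀ two_pos (by norm_num) h

theorem isWeightedHomogeneous_of_scaling {σ : Type*} {w : σ → ℤ} {P : MvPolynomial σ ℂ} {d : ℤ}
    (h : scaling w P = (2 : ℂ) ^ d • P) : IsWeightedHomogeneous w P d := by
  intro m hm
  have h' := congrArg (coeff m) h
  rw [coeff_scaling, coeff_smul, smul_eq_mul] at h'
  exact two_zpow_injective (mul_right_cancel₀ hm h')

variable {n : ℕ}

/-- The weight `w_i + 2 m` of the variable `∂_x^m z^i`. With this choice `∂_x` has degree `2` and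
the parameter `ε` has degree `0`. -/
def jetWeight (w : Fin n → ℤ) (p : Fin n × ℕ) : ℤ := w p.1 + 2 * p.2

theorem scaling_toDiffPoly (w : Fin n → ℤ) (P : MvPolynomial (Fin n) ℂ) :
    scaling (jetWeight w) (toDiffPoly P) = toDiffPoly (scaling w P) := by
  induction P using MvPolynomial.induction_on with
  | C a => simp [toDiffPoly]
  | add p q hp hq =>
    simp only [toDiffPoly, map_add] at hp hq ⊢
    rw [hp, hq]
  | mul_X p i hp =>
    simp only [toDiffPoly, map_mul] at hp ⊢
    rw [hp]
    simp [jetWeight]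

theorem toDiffPoly_injective : Function.Injective (toDiffPoly (n := n)) :=
  rename_injective _ fun _ _ h => congrArg Prod.fst h

/-- Conjugation of operators by the rescaling of the variables. -/
noncomputable def conjScaling (w : Fin n → ℤ) :
    Module.End ℂ (DiffPoly n) →ₐ[ℂ] Module.End ℂ (DiffPoly n) :=
  ((scaling (jetWeight w)).toLinearEquiv.conjAlgEquiv ℂ).toAlgHom

theorem conjScaling_apply (w : Fin n → ℤ) (T : Module.End ℂ (DiffPoly n)) (x : DiffPoly n) :
    conjScaling w T x = scaling (jetWeight w) (T ((scaling (jetWeight w)).symm x)) := rfl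

theorem conjScaling_mulLeft (w : Fin n → ℤ) (a : DiffPoly n) :
    conjScaling w (LinearMap.mulLeft ℂ a) = LinearMap.mulLeft ℂ (scaling (jetWeight w) a) := by
  refine LinearMap.ext fun x => ?_
  simp [conjScaling_apply]

theorem scaling_totalDeriv (w : Fin n → ℤ) (a : DiffPoly n) :
    scaling (jetWeight w) (totalDeriv n a) =
      (4 : ℂ) • totalDeriv n (scaling (jetWeight w) a) := by
  induction a using MvPolynomial.induction_on with
  | C a => simp [totalDeriv]
  | add p q hp hq => simp only [map_add, hp, hq, smul_add]
  | mul_X p i hp =>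
    have hX : scaling (jetWeight w) (totalDeriv n (X i)) =
        (4 : ℂ) • totalDeriv n (scaling (jetWeight w) (X i)) := by
      have h2 : (2 : ℂ) ^ jetWeight w (i.1, i.2 + 1) = 4 * 2 ^ jetWeight w i := by
        rw [show jetWeight w (i.1, i.2 + 1) = 2 + jetWeight w i by
          simp only [jetWeight]; push_cast; ring, zpow_add₀ two_ne_zero]
        norm_num
      simp [totalDeriv, smul_smul, h2]
    simp only [Derivation.leibniz, map_add, smul_eq_mul, map_mul, hp, hX, smul_add,
      mul_smul_comm]

theorem conjScaling_totalDeriv (w : Fin n → ℤ) :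
    conjScaling w (totalDeriv n).toLinearMap = (4 : ℂ) • (totalDeriv n).toLinearMap := by
  refine LinearMap.ext fun x => ?_
  have h := scaling_totalDeriv w ((scaling (jetWeight w)).symm x)
  rwa [AlgEquiv.apply_symm_apply] at h

/-- Conjugation by the rescaling of the variables, applied to the coefficients of the powers
of `ε`. -/
noncomputable def scaleOp (w : Fin n → ℤ) : LocalOp n →ₐ[ℂ] LocalOp n :=
  PowerSeries.mapAlgHom (conjScaling w)

theorem coeff_scaleOp (w : Fin n → ℤ) (m : ℕ) (S : LocalOp n) :
    PowerSeries.coeff m (scaleOp w S) = conjScaling w (PowerSeries.coeff m S) := rfl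

theorem pderiv_toDiffPoly_jet (k : Fin n) (P : MvPolynomial (Fin n) ℂ) :
    pderiv (k, 1) (toDiffPoly P) = 0 := by
  induction P using MvPolynomial.induction_on with
  | C a => simp [toDiffPoly]
  | add p q hp hq =>
    simp only [toDiffPoly, map_add] at hp hq ⊢
    rw [hp, hq, add_zero]
  | mul_X p i hp =>
    simp only [toDiffPoly, map_mul, Derivation.leibniz, rename_X] at hp ⊢
    rw [hp, pderiv_X_of_ne (by simp)]
    simp

theorem pderiv_sum_toDiffPoly (γ : Fin n → MvPolynomial (Fin n) ℂ) (k : Fin n) :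
    pderiv (k, 1) (∑ l, toDiffPoly (γ l) * X (l, 1)) = toDiffPoly (γ k) := by
  rw [map_sum, Finset.sum_eq_single k]
  · simp [Derivation.leibniz, pderiv_toDiffPoly_jet]
  · intro l _ hl
    simp [Derivation.leibniz, pderiv_toDiffPoly_jet, hl]
  · simp

variable {S : LocalOp n} {w : Fin n → ℤ} {d : ℤ}

/-- If the operator `S` is homogeneous of degree `d`, then so is its term of order `ε⁰`. -/
theorem isWeightedHomogeneous_of_coeff_zero (hS : scaleOp w S = (2 : ℂ) ^ d • S)
    {F : MvPolynomial (Fin n) ℂ}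
    (hF : PowerSeries.coeff 0 S = LinearMap.mulLeft ℂ (toDiffPoly F)) :
    IsWeightedHomogeneous w F d := by
  have h := congrArg (PowerSeries.coeff 0) hS
  rw [coeff_scaleOp, PowerSeries.coeff_smul, hF, conjScaling_mulLeft, scaling_toDiffPoly] at h
  have h1 := LinearMap.congr_fun h 1
  simp only [LinearMap.mulLeft_apply, LinearMap.smul_apply, mul_one] at h1
  refine isWeightedHomogeneous_of_scaling (toDiffPoly_injective ?_)
  rw [h1]
  simp [toDiffPoly]

/-- In the term of order `ε¹` of an operator of degree `d`, the operator `∂_x` accounts for the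
degree `2`, and the factor `z_x^k` for the degree `w_k + 2`. -/
theorem isWeightedHomogeneous_of_coeff_one [Nonempty (Fin n)]
    (hS : scaleOp w S = (2 : ℂ) ^ d • S)
    {g : MvPolynomial (Fin n) ℂ} {γ : Fin n → MvPolynomial (Fin n) ℂ}
    (hg : PowerSeries.coeff 1 S = LinearMap.mulLeft ℂ (toDiffPoly g) * (totalDeriv n).toLinearMap +
      LinearMap.mulLeft ℂ (∑ k, toDiffPoly (γ k) * X (k, 1))) :
    IsWeightedHomogeneous w g (d - 2) ∧
      ∀ k, IsWeightedHomogeneous w (γ k) (d - (w k + 2)) := by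
  have h := congrArg (PowerSeries.coeff 1) hS
  rw [coeff_scaleOp, PowerSeries.coeff_smul, hg, map_add, map_mul, conjScaling_mulLeft,
    conjScaling_mulLeft, conjScaling_totalDeriv, scaling_toDiffPoly] at h
  -- Evaluation at `1` isolates the term without `∂_x`, evaluation at `z^k` then gives `g`.
  have hone := LinearMap.congr_fun h 1
  simp only [LinearMap.add_apply, Module.End.mul_apply, LinearMap.smul_apply,
    LinearMap.mulLeft_apply, mul_one, Derivation.coeFn_coe,
    Derivation.map_one_eq_zero, smul_zero, mul_zero, zero_add] at hone
  constructor
  · obtain ⟨k⟩ := ‹Nonempty (Fin n)›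
    have hk := LinearMap.congr_fun h (X (k, 0))
    simp only [LinearMap.add_apply, Module.End.mul_apply, LinearMap.smul_apply,
      LinearMap.mulLeft_apply, Derivation.coeFn_coe, smul_add,
      hone, smul_mul_assoc] at hk
    have hk' := add_right_cancel hk
    rw [totalDeriv, mkDerivation_X, mul_smul_comm, ← smul_mul_assoc, ← smul_mul_assoc] at hk'
    have hk'' := mul_right_cancel₀ (X_ne_zero _) hk'
    refine isWeightedHomogeneous_of_scaling (toDiffPoly_injective ?_)
    have h4 : (2 : ℂ) ^ d = 4 * 2 ^ (d - 2) := by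
      rw [zpow_sub₀ two_ne_zero]
      norm_num
      ring
    rw [h4, mul_smul] at hk''
    have := smul_right_injective _ (by norm_num : (4 : ℂ) ≠ 0) hk''
    rw [this]
    simp [toDiffPoly]
  · intro k
    -- The polynomials `γ_l` do not involve `z_x^k`, so that `∂/∂z_x^k` extracts `γ_k`.
    have hk := congrArg (pderiv ((k, 1) : Fin n × ℕ)) hone
    have hsum : scaling (jetWeight w) (∑ l, toDiffPoly (γ l) * X (l, 1)) =
        ∑ l, toDiffPoly ((2 : ℂ) ^ (w l + 2) • scaling w (γ l)) * X (l, 1) := by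
      rw [map_sum]
      refine Finset.sum_congr rfl fun l _ => ?_
      rw [map_mul, scaling_toDiffPoly, scaling_X]
      simp [toDiffPoly, jetWeight]
    rw [hsum, pderiv_sum_toDiffPoly, Derivation.map_smul, pderiv_sum_toDiffPoly] at hk
    have hk' : (2 : ℂ) ^ (w k + 2) • scaling w (γ k) = (2 : ℂ) ^ d • γ k := by
      refine toDiffPoly_injective (hk.trans ?_)
      simp [toDiffPoly]
    refine isWeightedHomogeneous_of_scaling ?_
    have hd : (2 : ℂ) ^ d = 2 ^ (w k + 2) * 2 ^ (d - (w k + 2)) := by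
      rw [← zpow_add₀ two_ne_zero]
      congr 1
      ring
    rw [hd, mul_smul] at hk'
    exact smul_right_injective _ (zpow_ne_zero (w k + 2) (two_ne_zero (α := ℂ))) hk'

end Scaling

/-! ### Homogeneity of the Dirac reduction -/

section Dirac

variable {R J ι κ : Type*} [Ring R] [Algebra ℂ R] [Fintype κ] [DecidableEq κ]

/-- If an endomorphism multiplies the entries of a Poisson matrix by factors `u_p u_q`, then it acts
in the same way on the Dirac reduction, because it multiplies the entries of the inverse by the
inverse factors. -/
theorem map_diracReduction_apply (φ : R →ₐ[ℂ] R) {P : Matrix J J R} (s : ι → J) (t : κ → J)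
    (hP : IsUnit (P.submatrix t t)) {u : J → ℂ} (hu : ∀ p, u p ≠ 0)
    (hφ : ∀ p q, φ (P p q) = (u p * u q) • P p q) (i j : ι) :
    φ (diracReduction P s t i j) = (u (s i) * u (s j)) • diracReduction P s t i j := by
  set A := P.submatrix t t with hA
  have hAinv : A * Ring.inverse A = 1 := Ring.mul_inverse_cancel A hP
  have hinvA : Ring.inverse A * A = 1 := Ring.inverse_mul_cancel A hP
  set A' : Matrix κ κ R :=
    Matrix.of fun α β => ((u (t α))⁻¹ * (u (t β))⁻¹) • Ring.inverse A α β with hA'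
  have h₁ : φ.mapMatrix A * A' = 1 := by
    ext α β
    have h := congrFun (congrFun hAinv α) β
    rw [Matrix.mul_apply] at h ⊢
    have hterm : ∀ k, φ.mapMatrix A α k * A' k β =
        (u (t α) * (u (t β))⁻¹) • (A α k * Ring.inverse A k β) := by
      intro k
      rw [AlgHom.mapMatrix_apply, Matrix.map_apply, hA, Matrix.submatrix_apply,
        hφ, hA', Matrix.of_apply,
        smul_mul_smul_comm]
      congr 1
      field_simp [hu (t k)]
    rw [Finset.sum_congr rfl fun k _ => hterm k, ← Finset.smul_sum, h]
    by_cases hαβ : α = β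
    · rw [hαβ, mul_inv_cancel₀ (hu _), one_smul]
    · rw [Matrix.one_apply_ne hαβ, smul_zero]
  have h₂ : φ.mapMatrix (Ring.inverse A) * φ.mapMatrix A = 1 := by
    rw [← map_mul, hinvA, map_one]
  have h₃ : φ.mapMatrix (Ring.inverse A) = A' := left_inv_eq_right_inv h₂ h₁
  have h₄ : ∀ α β, φ (Ring.inverse A α β) =
      ((u (t α))⁻¹ * (u (t β))⁻¹) • Ring.inverse A α β := fun α β =>
    congrFun (congrFun h₃ α) β
  simp only [diracReduction, ← hA, Matrix.sub_apply, Matrix.mul_apply, map_sub, map_sum, map_mul,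
    Matrix.submatrix_apply, hφ, h₄, smul_sub, Finset.sum_mul, Finset.smul_sum, smul_mul_smul_comm]
  congr 1
  refine Finset.sum_congr rfl fun β _ => Finset.sum_congr rfl fun α _ => ?_
  congr 1
  have := hu (t α)
  have := hu (t β)
  field_simp

end Dirac

/-! ### The dual basis and the gradation by the eigenvalues of `ad h` -/

section NormalizedForm

variable {L : Type*} [LieRing L] [LieAlgebra ℂ L] {e f : L}

theorem normalizedForm_lie_left (x y z : L) :
    normalizedForm e f ⁅x, y⁆ z = -normalizedForm e f y ⁅x, z⁆ := by
  rw [← lie_skew x y]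
  simp only [normalizedForm, LinearMap.smul_apply, map_neg, LinearMap.neg_apply]
  rw [killingForm, LieModule.traceForm_apply_lie_apply]

theorem normalizedForm_eq_zero_of_lie_eq_smul {h x y : L} {a b : ℂ} (hx : ⁅h, x⁆ = a • x)
    (hy : ⁅h, y⁆ = b • y) (hab : a + b ≠ 0) : normalizedForm e f x y = 0 := by
  have h1 := normalizedForm_lie_left (e := e) (f := f) h x y
  rw [hx, hy, map_smul, map_smul, LinearMap.smul_apply, smul_eq_mul, smul_eq_mul] at h1
  have h2 : (a + b) * normalizedForm e f x y = 0 := by linear_combination h1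
  exact (mul_eq_zero.mp h2).resolve_left hab

theorem lie_lie_eq_smul {h x y : L} {a b : ℂ} (hx : ⁅h, x⁆ = a • x) (hy : ⁅h, y⁆ = b • y) :
    ⁅h, ⁅x, y⁆⁆ = (a + b) • ⁅x, y⁆ := by
  rw [leibniz_lie, hx, hy, smul_lie, lie_smul, add_smul]

end NormalizedForm

namespace NormalizedBasis

open MvPolynomial

variable {L : Type*} [LieRing L] [LieAlgebra ℂ L] {e h f : L} {r : ℕ} {η : Fin (r + 2) → ℕ}

/-- The index `(i, -I)` of the basis vector paired with `X_I^i`. -/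
def negIdx (p : WtIdx η) : WtIdx η :=
  ⟨p.1, ⟨-(p.2 : ℤ), by
    have := p.2.2
    simp only [Set.mem_Icc] at this ⊢
    omega⟩⟩

theorem wtIdx_ext {p q : WtIdx η} (h₁ : p.1 = q.1) (h₂ : (p.2 : ℤ) = q.2) : p = q := by
  obtain ⟨i, I, hI⟩ := p
  obtain ⟨j, J, hJ⟩ := q
  simp only at h₁ h₂
  subst h₁
  subst h₂
  rfl

theorem form_X_X (N : NormalizedBasis e h f η) (p q : WtIdx η) :
    normalizedForm e f (N.X p) (N.X q) =
      if q = negIdx p then normalizedForm e f (N.X p) (N.X (negIdx p)) else 0 := by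
  split_ifs with hq
  · rw [hq]
  · rw [← basisVec_coe N.X p, ← basisVec_coe N.X q, N.form_apply _ _ _ p.2.2 _ q.2.2, if_neg]
    rintro ⟨h₁, h₂⟩
    exact hq (wtIdx_ext h₁.symm (by simp only [negIdx]; omega))

theorem form_X_negIdx_ne_zero (N : NormalizedBasis e h f η) (p : WtIdx η) :
    normalizedForm e f (N.X p) (N.X (negIdx p)) ≠ 0 := by
  intro h0
  refine N.X.ne_zero p (N.nondegenerate.1 _ fun y => ?_)
  have hzero : normalizedForm e f (N.X p) = 0 := N.X.ext fun q => by
    rw [N.form_X_X, h0, ite_self, LinearMap.zero_apply]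
  rw [hzero, LinearMap.zero_apply]

theorem dual_eq (N : NormalizedBasis e h f η) (p : WtIdx η) :
    N.dual p = (normalizedForm e f (N.X p) (N.X (negIdx p)))⁻¹ • N.X (negIdx p) := by
  rw [← sub_eq_zero]
  refine N.nondegenerate.1 _ fun y => ?_
  have hzero : normalizedForm e f (N.dual p -
      (normalizedForm e f (N.X p) (N.X (negIdx p)))⁻¹ • N.X (negIdx p)) = 0 := N.X.ext fun q => by
    rw [map_sub, map_smul, LinearMap.sub_apply, LinearMap.smul_apply, dual,
      LinearMap.BilinForm.apply_dualBasis_left, normalizedForm_symm (N.X (negIdx p)) (N.X q),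
      N.form_X_X q, LinearMap.zero_apply]
    by_cases hqp : q = p
    · rw [hqp, if_pos rfl, if_pos rfl, smul_eq_mul, inv_mul_cancel₀ (N.form_X_negIdx_ne_zero p),
        sub_self]
    · rw [if_neg hqp, if_neg, smul_zero, sub_zero]
      intro hneg
      have h₁ := congrArg Sigma.fst hneg
      have h₂ : ((negIdx p).2 : ℤ) = (negIdx q).2 := by rw [hneg]
      simp only [negIdx] at h₁ h₂
      exact hqp (wtIdx_ext h₁.symm (by omega))
  rw [hzero, LinearMap.zero_apply]

theorem form_dual_X (N : NormalizedBasis e h f η) (p q : WtIdx η) :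
    normalizedForm e f (N.dual p) (N.X q) = if q = p then 1 else 0 :=
  LinearMap.BilinForm.apply_dualBasis_left _ _ _ _

theorem lie_h_X (N : NormalizedBasis e h f η) (p : WtIdx η) :
    ⁅h, N.X p⁆ = (2 * ((p.2 : ℤ) : ℂ)) • N.X p := by
  rw [← basisVec_coe N.X p]
  exact N.lie_h _ _ p.2.2

theorem lie_h_dual (N : NormalizedBasis e h f η) (p : WtIdx η) :
    ⁅h, N.dual p⁆ = (-(2 * ((p.2 : ℤ) : ℂ))) • N.dual p := by
  rw [N.dual_eq, lie_smul, N.lie_h_X, smul_comm]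
  congr 2
  simp [negIdx]

theorem form_dual_dual_eq_zero (N : NormalizedBasis e h f η) {p q : WtIdx η}
    (hpq : (p.2 : ℤ) + q.2 ≠ 0) : normalizedForm e f (N.dual p) (N.dual q) = 0 := by
  refine normalizedForm_eq_zero_of_lie_eq_smul (N.lie_h_dual p) (N.lie_h_dual q) fun h0 => hpq ?_
  have h1 : (((p.2 : ℤ) + q.2 : ℤ) : ℂ) = 0 := by
    push_cast
    linear_combination (-1 / 2 : ℂ) * h0
  exact_mod_cast h1

theorem form_dual_lie_e_dual_eq_zero (N : NormalizedBasis e h f η) (ht : IsSl2Triple h e f)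
    {p q : WtIdx η} (hpq : (p.2 : ℤ) + q.2 ≠ 1) :
    normalizedForm e f (N.dual p) ⁅e, N.dual q⁆ = 0 := by
  have he : ⁅h, e⁆ = (2 : ℂ) • e := by rw [ht.lie_h_e_nsmul, two_nsmul, two_smul]
  refine normalizedForm_eq_zero_of_lie_eq_smul (N.lie_h_dual p)
    (lie_lie_eq_smul he (N.lie_h_dual q)) fun h0 => hpq ?_
  have h1 : (((p.2 : ℤ) + q.2 : ℤ) : ℂ) = (1 : ℤ) := by
    push_cast
    linear_combination (-1 / 2 : ℂ) * h0
  exact_mod_cast h1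

theorem form_dual_lie_low_dual_eq_zero (N : NormalizedBasis e h f η) (i : Fin (r + 2))
    {p q : WtIdx η} (hpq : (p.2 : ℤ) + q.2 ≠ -(η i : ℤ)) :
    normalizedForm e f (N.dual p) ⁅N.X (lowIdx η i), N.dual q⁆ = 0 := by
  refine normalizedForm_eq_zero_of_lie_eq_smul (N.lie_h_dual p)
    (lie_lie_eq_smul (N.lie_h_X _) (N.lie_h_dual q)) fun h0 => hpq ?_
  simp only [lowIdx] at h0
  have h1 : (((p.2 : ℤ) + q.2 : ℤ) : ℂ) = (-(η i : ℤ) : ℤ) := by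
    push_cast at h0 ⊢
    linear_combination (-1 / 2 : ℂ) * h0
  exact_mod_cast h1

/-! ### The Lie-Poisson structure on the slice and its constraint block -/

/-- The entry `⟨ξ^I, [q, ξ^J]⟩` as a polynomial function on the slice. -/
noncomputable def liePoissonPoly (N : NormalizedBasis e h f η) :
    Matrix (WtIdx η) (WtIdx η) (MvPolynomial (Fin (r + 2)) ℂ) :=
  Matrix.of fun p q => C (normalizedForm e f (N.dual p) ⁅e, N.dual q⁆) +
    ∑ i, C (normalizedForm e f (N.dual p) ⁅N.X (lowIdx η i), N.dual q⁆) * MvPolynomial.X i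

theorem toDiffPoly_liePoissonPoly (N : NormalizedBasis e h f η) (p q : WtIdx η) :
    toDiffPoly (N.liePoissonPoly p q) = N.liePoissonEntry p q := by
  simp [liePoissonPoly, liePoissonEntry, toDiffPoly]

theorem coeff_zero_loopOperator (N : NormalizedBasis e h f η) (p q : WtIdx η) :
    PowerSeries.coeff 0 (N.loopOperator p q) = mulOp (r + 2) (N.liePoissonPoly p q) := by
  rw [mulOp_apply, toDiffPoly_liePoissonPoly]
  simp [loopOperator]

theorem loopOperator_mem_leadingSubring (N : NormalizedBasis e h f η) (p q : WtIdx η) :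
    N.loopOperator p q ∈ leadingSubring (r + 2) := by
  refine ⟨_, C (normalizedForm e f (N.dual p) (N.dual q)), 0, N.coeff_zero_loopOperator p q, ?_⟩
  have h₁ : PowerSeries.coeff 1 (N.loopOperator p q) =
      normalizedForm e f (N.dual p) (N.dual q) • (totalDeriv (r + 2)).toLinearMap := by
    simp [loopOperator]
  rw [h₁]
  refine LinearMap.ext fun x => ?_
  simp [mulOp_apply, linOp, toDiffPoly, MvPolynomial.smul_eq_C_mul]

/-- The index `(i, 1 - I)`; the vector `[e, ξ^{(i, I)}]` is a multiple of `X_{1 - I}^i`. -/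
def reflectIdx (p : ConIdx η) : ConIdx η :=
  ⟨⟨p.1.1, ⟨1 - (p.1.2 : ℤ), by
    have h₁ := p.1.2.2
    have h₂ := p.2
    simp only [Set.mem_Icc] at h₁ ⊢
    omega⟩⟩, by
    have h₁ := p.1.2.2
    simp only [Set.mem_Icc] at h₁
    simp only [ne_eq]
    omega⟩

theorem reflectIdx_involutive : Function.Involutive (reflectIdx (η := η)) := by
  intro p
  refine Subtype.ext (wtIdx_ext rfl ?_)
  simp [reflectIdx]

theorem lie_e_dual (N : NormalizedBasis e h f η) (p : ConIdx η) :
    ∃ c : ℂ, c ≠ 0 ∧ ⁅e, N.dual p⁆ = c • N.X (reflectIdx p) := by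
  have hp := p.1.2.2
  have hp' := p.2
  simp only [Set.mem_Icc] at hp
  refine ⟨(normalizedForm e f (N.X p) (N.X (negIdx p)))⁻¹ *
    ((η p.1.1 : ℂ) + ((-(p.1.2 : ℤ) : ℤ) : ℂ) + 1),
    mul_ne_zero (inv_ne_zero (N.form_X_negIdx_ne_zero p)) ?_, ?_⟩
  · have : (η p.1.1 : ℤ) + -(p.1.2 : ℤ) + 1 ≠ 0 := by omega
    exact_mod_cast this
  · rw [N.dual_eq, lie_smul, ← basisVec_coe N.X (negIdx p), N.lie_e _ _ (negIdx p.1).2.2, smul_smul,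
      ← basisVec_coe N.X (reflectIdx p)]
    congr 2
    simp only [negIdx, reflectIdx]
    ring

/-- Composed with the reflection `I ↦ 1 - I` of the rows, the constraint block of the Lie-Poisson
matrix is block triangular with respect to the order by `-I`, with constant invertible diagonal
blocks: `ad e` gives the diagonal, and the vectors `X_{-η_i}^i` of nonpositive weight give entries
strictly on one side of it. -/
theorem isUnit_liePoissonPoly_submatrix (N : NormalizedBasis e h f η) (ht : IsSl2Triple h e f) :
    IsUnit (N.liePoissonPoly.submatrix (Subtype.val : ConIdx η → WtIdx η)
      (Subtype.val : ConIdx η → WtIdx η)) := by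
  set σ : ConIdx η ≃ ConIdx η := reflectIdx_involutive.toPerm _ with hσ
  rw [← Matrix.isUnit_submatrix_equiv σ (Equiv.refl _)]
  set M := (N.liePoissonPoly.submatrix (Subtype.val : ConIdx η → WtIdx η)
    (Subtype.val : ConIdx η → WtIdx η)).submatrix σ (Equiv.refl _) with hM
  have hlow : ∀ p q : ConIdx η, (p.1.2 : ℤ) ≤ q.1.2 →
      M p q = C (normalizedForm e f (N.dual (reflectIdx p)) ⁅e, N.dual q⁆) := by
    intro p q hpq
    have hsum : ∑ i, C (σ := Fin (r + 2)) (normalizedForm e f (N.dual (reflectIdx p))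
        ⁅N.X (lowIdx η i), N.dual q⁆) * MvPolynomial.X i = 0 := Finset.sum_eq_zero fun i _ => by
      rw [N.form_dual_lie_low_dual_eq_zero i, C_0, zero_mul]
      simp only [reflectIdx]
      omega
    exact (congrArg (C _ + ·) hsum).trans (add_zero _)
  set b : ConIdx η → ℤ := fun p => -(p.1.2 : ℤ) with hb
  have htri : M.BlockTriangular b := by
    intro p q hpq
    simp only [hb] at hpq
    rw [hlow p q (by omega), N.form_dual_lie_e_dual_eq_zero ht, C_0]
    simp only [reflectIdx]
    omega
  have hentry : ∀ q : ConIdx η, ∃ c : ℂ, c ≠ 0 ∧ ∀ p : ConIdx η,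
      normalizedForm e f (N.dual (reflectIdx p)) ⁅e, N.dual q⁆ = if p = q then c else 0 := by
    intro q
    obtain ⟨c, hc, hcq⟩ := N.lie_e_dual q
    refine ⟨c, hc, fun p => ?_⟩
    rw [hcq, map_smul, N.form_dual_X, smul_eq_mul]
    by_cases hpq : p = q
    · rw [if_pos (by rw [hpq]), if_pos hpq, mul_one]
    · rw [if_neg, if_neg hpq, mul_zero]
      intro heq
      exact hpq (reflectIdx_involutive.injective (Subtype.ext heq.symm))
  choose c hc hcM using hentry
  rw [Matrix.isUnit_iff_isUnit_det, htri.det]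
  refine IsUnit.prod_iff.mpr fun a _ => ?_
  have hblock : M.toSquareBlock b a = Matrix.diagonal fun p => C (c p.1) := by
    ext1 p q
    have hpq : (p.1.1.2 : ℤ) = q.1.1.2 := by
      have := p.2.trans q.2.symm
      simp only [hb] at this
      omega
    rw [Matrix.toSquareBlock_def, Matrix.of_apply, hlow _ _ hpq.le, hcM, Matrix.diagonal_apply]
    by_cases h : p = q
    · rw [if_pos (congrArg Subtype.val h), if_pos h, h]
    · rw [if_neg (fun h' => h (Subtype.ext h')), if_neg h, C_0]
  rw [hblock, Matrix.det_diagonal]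
  exact IsUnit.prod_iff.mpr fun p _ => (isUnit_iff_ne_zero.mpr (hc p.1)).map C

theorem isUnit_constraintOperator (N : NormalizedBasis e h f η) (ht : IsSl2Triple h e f) :
    IsUnit N.constraintOperator := by
  refine Matrix.isUnit_of_isUnit_map_constantCoeff ?_
  have hmap : N.constraintOperator.map (PowerSeries.coeff 0) = (mulOp (r + 2)).mapMatrix
      (N.liePoissonPoly.submatrix (Subtype.val : ConIdx η → WtIdx η)
        (Subtype.val : ConIdx η → WtIdx η)) := by
    ext1 p q
    exact N.coeff_zero_loopOperator p q
  rw [hmap]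
  exact (N.isUnit_liePoissonPoly_submatrix ht).map _

theorem sliceOperator_mem_leadingSubring (N : NormalizedBasis e h f η) (ht : IsSl2Triple h e f)
    (i j : Fin (r + 2)) : N.sliceOperator i j ∈ leadingSubring (r + 2) := by
  have hmem := N.loopOperator_mem_leadingSubring
  have hinv : ∀ p q, Ring.inverse N.constraintOperator p q ∈ leadingSubring (r + 2) :=
    inverse_apply_mem_leadingSubring (N.isUnit_liePoissonPoly_submatrix ht)
      (M := N.constraintOperator) (fun p q => N.coeff_zero_loopOperator p q)
      (fun p q => hmem _ _)
      (Ring.inverse_mul_cancel _ (N.isUnit_constraintOperator ht))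
  exact Subring.sub_mem _ (hmem _ _)
    (mul_apply_mem_leadingSubring (mul_apply_mem_leadingSubring (fun _ _ => hmem _ _) hinv)
      (fun _ _ => hmem _ _) i j)

/-! ### Quasihomogeneity of the reduced bracket -/

/-- The entry `𝔽^{IJ}` is homogeneous of degree `(1 - 2 I) + (1 - 2 J)`: the term with `e` occurs
for `I + J = 1`, the term with `z^i`, of degree `2 η_i + 2`, for `I + J = -η_i`, and the term
with `∂_x`, of degree `2`, for `I + J = 0`. -/
theorem scaleOp_loopOperator (N : NormalizedBasis e h f η) (ht : IsSl2Triple h e f)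
    (p q : WtIdx η) :
    scaleOp (slodowyDegree η) (N.loopOperator p q) =
      ((2 : ℂ) ^ (1 - 2 * (p.2 : ℤ)) * 2 ^ (1 - 2 * (q.2 : ℤ))) • N.loopOperator p q := by
  rw [← zpow_add₀ two_ne_zero]
  set d : ℤ := 1 - 2 * (p.2 : ℤ) + (1 - 2 * (q.2 : ℤ)) with hd
  have hentry : scaling (jetWeight (slodowyDegree η)) (N.liePoissonEntry p q) =
      (2 : ℂ) ^ d • N.liePoissonEntry p q := by
    simp only [liePoissonEntry, map_add, map_sum, map_mul, scaling_C, scaling_X, smul_add,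
      Finset.smul_sum]
    congr 1
    · by_cases h1 : (p.2 : ℤ) + q.2 = 1
      · rw [show d = 0 by omega, zpow_zero, one_smul]
      · rw [N.form_dual_lie_e_dual_eq_zero ht h1, C_0, smul_zero]
    · refine Finset.sum_congr rfl fun i _ => ?_
      by_cases h1 : (p.2 : ℤ) + q.2 = -(η i : ℤ)
      · rw [mul_smul_comm, show jetWeight (slodowyDegree η) (i, 0) = d by
          simp only [jetWeight, slodowyDegree]
          push_cast
          omega]
      · rw [N.form_dual_lie_low_dual_eq_zero i h1, C_0, zero_mul, zero_mul, smul_zero]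
  have hform : (4 : ℂ) * normalizedForm e f (N.dual p) (N.dual q) =
      2 ^ d * normalizedForm e f (N.dual p) (N.dual q) := by
    by_cases h1 : (p.2 : ℤ) + q.2 = 0
    · rw [show d = 2 by omega]
      norm_num
    · rw [N.form_dual_dual_eq_zero h1, mul_zero, mul_zero]
  ext1 m
  rw [coeff_scaleOp, PowerSeries.coeff_smul]
  rcases m with _ | _ | m
  · rw [N.coeff_zero_loopOperator, mulOp_apply, conjScaling_mulLeft, toDiffPoly_liePoissonPoly,
      hentry]
    refine LinearMap.ext fun x => ?_
    simp
  · have h₁ : PowerSeries.coeff (0 + 1) (N.loopOperator p q) =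
        normalizedForm e f (N.dual p) (N.dual q) • (totalDeriv (r + 2)).toLinearMap := by
      simp [loopOperator]
    rw [h₁, map_smul, conjScaling_totalDeriv, smul_smul, smul_smul, mul_comm, hform]
  · have h₂ : PowerSeries.coeff (m + 1 + 1) (N.loopOperator p q) = 0 := by
      simp [loopOperator, PowerSeries.coeff_X]
    rw [h₂, map_zero, smul_zero]

theorem scaleOp_sliceOperator (N : NormalizedBasis e h f η) (ht : IsSl2Triple h e f)
    (i j : Fin (r + 2)) :
    scaleOp (slodowyDegree η) (N.sliceOperator i j) =
      (2 : ℂ) ^ (slodowyDegree η i + slodowyDegree η j - 2) • N.sliceOperator i j := by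
  have key := map_diracReduction_apply (scaleOp (slodowyDegree η)) (lowIdx η)
    (Subtype.val : ConIdx η → WtIdx η) (N.isUnit_constraintOperator ht)
    (u := fun p => (2 : ℂ) ^ (1 - 2 * (p.2 : ℤ))) (fun p => zpow_ne_zero _ two_ne_zero)
    (N.scaleOp_loopOperator ht) i j
  rw [← zpow_add₀ two_ne_zero] at key
  refine key.trans ?_
  have hdeg : 1 - 2 * ((lowIdx η i).2 : ℤ) + (1 - 2 * ((lowIdx η j).2 : ℤ)) =
      slodowyDegree η i + slodowyDegree η j - 2 := by
    simp only [lowIdx, slodowyDegree]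
    ring
  rw [hdeg]
  rfl

end NormalizedBasis

theorem mainTheorem6 {L : Type*} [LieRing L] [LieAlgebra ℂ L] [FiniteDimensional ℂ L]
    [LieAlgebra.IsSimple ℂ L] (r : ℕ) (hL : IsTypeEvenDOrE L r)
    (e h f : L) (he : IsSubregularNilpotent r e) (ht : IsSl2Triple h e f)
    (η : Fin (r + 2) → ℕ) (N : NormalizedBasis e h f η) :
    IsUnit N.constraintOperator ∧
    (∃ (F g : Matrix (Fin (r + 2)) (Fin (r + 2)) (MvPolynomial (Fin (r + 2)) ℂ))
      (Γ : Fin (r + 2) → Fin (r + 2) → Fin (r + 2) → MvPolynomial (Fin (r + 2)) ℂ),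
      HasLeadingTerms N.sliceOperator F g Γ) ∧
    ∀ (F g : Matrix (Fin (r + 2)) (Fin (r + 2)) (MvPolynomial (Fin (r + 2)) ℂ))
      (Γ : Fin (r + 2) → Fin (r + 2) → Fin (r + 2) → MvPolynomial (Fin (r + 2)) ℂ),
      HasLeadingTerms N.sliceOperator F g Γ →
        IsQuasihomogeneousMatrix (slodowyDegree η) g (-4) ∧
        IsQuasihomogeneousMatrix (slodowyDegree η) F (-2) ∧
        ∀ k, IsQuasihomogeneousMatrix (slodowyDegree η) (Matrix.of fun i j => Γ i j k)
          (-(2 * (η k : ℤ) + 2) - 4) := by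
  refine ⟨N.isUnit_constraintOperator ht, ?_, fun F g Γ hS => ⟨fun i j => ?_, fun i j => ?_,
    fun k i j => ?_⟩⟩
  · choose F g Γ h₀ h₁ using N.sliceOperator_mem_leadingSubring ht
    exact ⟨F, g, Γ, fun i j => ⟨h₀ i j, h₁ i j⟩⟩
  · have := (isWeightedHomogeneous_of_coeff_one (N.scaleOp_sliceOperator ht i j) (hS i j).2).1
    rwa [show slodowyDegree η i + slodowyDegree η j - 2 - 2 =
      slodowyDegree η i + slodowyDegree η j + -4 by ring] at this
  · exact isWeightedHomogeneous_of_coeff_zero (N.scaleOp_sliceOperator ht i j) (hS i j).1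
  · have := (isWeightedHomogeneous_of_coeff_one (N.scaleOp_sliceOperator ht i j) (hS i j).2).2 k
    rwa [show slodowyDegree η i + slodowyDegree η j - 2 - (slodowyDegree η k + 2) =
      slodowyDegree η i + slodowyDegree η j + (-(2 * (η k : ℤ) + 2) - 4) by
        simp only [slodowyDegree]; ring] at this
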